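/- **Theorem 4.3.** *Setting.* For $p\ge 1$ and a real $p\times p$ matrix $\Sigma=(\sigma_{ij})$ let $\ell_r(\Sigma)=\max_{i}\sum_{j}|\sigma_{ij}|^r$, and let $\mathrm{offdiag}(\Sigma)$ be $\Sigma$ with its diagonal replaced by $0$. For $q\ge 0$ and $R>0$ let $\mathcal G_q(R)$ be the set of positive semidefinite $p\times p$ matrices $\Sigma$ with unit diagonal and $\max_i\sum_j|\sigma_{ij}|^q\le R$ (with $0^0=0$). Given i.i.d. observations $X_1,\dots,X_n$ in $\mathbb R^p$, $n\ge1$, let $\hat\Sigma=(\hat\sigma_{ij})=\frac1n\sum_{k}X_kX_k^\top$, and for $\tau>0$ let $\tilde\Sigma_\tau$ have the entries $\hat\sigma_{ii}$ on the diagonal and $\hat\sigma_{ij}\mathbf 1\{|\hat\sigma_{ij}|>\tau\}$ for $i\ne j$. Consider the problem of testing $$H_0:\ X_k\sim\mathcal N(0,I_p)\qquad\text{vs.}\qquad H_1:\ X_k\sim\mathcal N\bigl(0,I_p+\kappa\,\mathrm{offdiag}(\Sigma)\bigr),\quad \Sigma\in\bigcup_{q'\in[0,q]}\bigl\{\Sigma\in\mathcal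 G_{q'}(R):\ \ell_r(\mathrm{offdiag}(\Sigma))=1\bigr\}.$$ A test $\psi\in\{0,1\}$ discriminates between $H_0$ and $H_1$ with accuracy $\delta$ if $\mathbb P_{H_0}(\psi=1)\vee\mathbb P_{H_1}(\psi=0)\le\delta$, where $\mathbb P_{H_1}$ denotes the largest probability over the alternative. *Statement.* Let $r>0$ and $C_0\ge 4$. There are constants $0<C_1\le C$, depending only on $r$ and $C_0$, with the following property. Let $n,p\ge1$, $\max\{r-1,0\}\le q<r$, $R\ge1$ and $\delta\in(0,1)$, put $$\tau=2C_0\sqrt{\frac{2\log p+\log(4/\delta)}{n}},\qquad \bar\kappa=2CR^{1/r}\Bigl(\frac{2\log p+\log(4/\delta)}{n}\Bigr)^{\frac{r-q}{2r}},$$ and, for $\kappa>0$, $$s_0=1+C_1R\Bigl(\frac{2\log p+\log(4/\delta)}{n}\Bigr)^{\frac{r-q}{2}},\qquad s_1=1+\kappa^r-C_1R\Bigl(\frac{2\log p+\log(4/\delta)}{n}\Bigr)^{\frac{r-q}{2}}.$$ If $\bar\kappa<1$, then for every $\kappa\in(\bar\kappa,1]$ one has $s_0<s_1$, and for every $s\in[s_0,s_1]$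 the test $\psi=\mathbf 1\{\ell_r(\tilde\Sigma_\tau)\ge s\}$ discriminates between $H_0$ and $H_1$ with accuracy $\delta$. -/

import Mathlib

open MeasureTheory ProbabilityTheory

noncomputable section

namespace CorrDetect

/-- `|x| ^ q` with the convention `0 ^ 0 = 0`, so that for `q = 0` the sum
`∑ j, absPow q (x j)` counts the nonzero entries. -/
def absPow (q x : ℝ) : ℝ := if x = 0 then 0 else |x| ^ q

/-- The `ℓ_r` functional: the maximum over the rows `i` of `∑ j, |σ i j| ^ r`
(used for `r > 0`). -/
def ellFunctional {p : ℕ} (r : ℝ) (S : Matrix (Fin p) (Fin p) ℝ) : ℝ :=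
  ⨆ i, ∑ j, |S i j| ^ r

/-- The linear operator that sets the diagonal entries of a square matrix to zero. -/
def offdiag {p : ℕ} (S : Matrix (Fin p) (Fin p) ℝ) : Matrix (Fin p) (Fin p) ℝ :=
  Matrix.of fun i j => if i = j then 0 else S i j

/-- The class `𝒢_q(R)` of positive semidefinite `p × p` matrices with unit diagonal, all of whose
rows satisfy `∑ j, |σ i j| ^ q ≤ R`. -/
def sparseCorr (p : ℕ) (q R : ℝ) : Set (Matrix (Fin p) (Fin p) ℝ) :=
  {S | S.PosSemidef ∧ (∀ i, ∑ j, absPow q (S i j) ≤ R) ∧ ∀ i, S i i = 1}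

/-- The data set: `n` observations in `ℝ^p`. -/
abbrev Sample (n p : ℕ) : Type := Fin n → EuclideanSpace ℝ (Fin p)

/-- The empirical covariance matrix `(1/n) ∑ k, X_k X_kᵀ`. -/
def empCov {n p : ℕ} (X : Sample n p) : Matrix (Fin p) (Fin p) ℝ :=
  Matrix.of fun i j => (1 / (n : ℝ)) * ∑ k, X k i * X k j

/-- The thresholding estimator: off-diagonal entries of the empirical covariance matrix that do not
exceed `τ` in absolute value are set to zero, the diagonal is kept. -/
def threshCov {n p : ℕ} (τ : ℝ) (X : Sample n p) : Matrix (Fin p) (Fin p) ℝ :=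
  Matrix.of fun i j =>
    if i = j then empCov X i j else if τ < |empCov X i j| then empCov X i j else 0

/-- The test `𝟙{ℓ_r(threshCov τ X) ≥ s}`. -/
def corrTest {n p : ℕ} (r τ s : ℝ) (X : Sample n p) : Fin 2 :=
  if s ≤ ellFunctional r (threshCov τ X) then 1 else 0

/-- The law of `n` i.i.d. observations from `N(0, G)`. -/
def gaussianSample (n : ℕ) {p : ℕ} (G : Matrix (Fin p) (Fin p) ℝ) : Measure (Sample n p) :=
  Measure.pi fun _ => multivariateGaussian 0 G

/-- The matrices `S` that index the alternative: those in the union of the classes `𝒢_{q'}(R)` over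
`q' ∈ [0, q]`, with `ℓ_r(offdiag S) = 1`. -/
def altParams (p : ℕ) (r q R : ℝ) : Set (Matrix (Fin p) (Fin p) ℝ) :=
  {S | S ∈ (⋃ q' ∈ Set.Icc (0 : ℝ) q, sparseCorr p q' R) ∧ ellFunctional r (offdiag S) = 1}

/-- The test `ψ` discriminates with accuracy `δ` between `H₀ : X ~ N(0, I_p)` and
`H₁ : X ~ N(0, I_p + κ offdiag(S))`, `S ∈ A`, from `n` i.i.d. observations: the maximum of the
type I error and of the largest type II error is at most `δ`. -/
def Discriminates {n p : ℕ} (ψ : Sample n p → Fin 2) (κ : ℝ)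
    (A : Set (Matrix (Fin p) (Fin p) ℝ)) (δ : ℝ) : Prop :=
  max (gaussianSample n (1 : Matrix (Fin p) (Fin p) ℝ) {X | ψ X = 1})
    (⨆ S ∈ A, gaussianSample n (1 + κ • offdiag S) {X | ψ X = 0}) ≤ ENNReal.ofReal δ

/-- The noise level `(2 log p + log(4/δ)) / n`. -/
def noise (n p : ℕ) (δ : ℝ) : ℝ := (2 * Real.log p + Real.log (4 / δ)) / n

/-- The threshold `τ = 2 C₀ √((2 log p + log(4/δ)) / n)`. -/
def tau (C₀ : ℝ) (n p : ℕ) (δ : ℝ) : ℝ := 2 * C₀ * √(noise n p δ)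

/-- `κ̄ = 2 C R^{1/r} ((2 log p + log(4/δ)) / n)^{(r-q)/(2r)}`. -/
def kappaBar (C : ℝ) (n p : ℕ) (r q R δ : ℝ) : ℝ :=
  2 * C * R ^ (1 / r) * noise n p δ ^ ((r - q) / (2 * r))

/-- `s₀ = 1 + C R ((2 log p + log(4/δ)) / n)^{(r-q)/2}`. -/
def sLow (C : ℝ) (n p : ℕ) (r q R δ : ℝ) : ℝ :=
  1 + C * R * noise n p δ ^ ((r - q) / 2)

/-- `s₁ = 1 + κ^r - C R ((2 log p + log(4/δ)) / n)^{(r-q)/2}`. -/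
def sHigh (C : ℝ) (n p : ℕ) (r q R δ κ : ℝ) : ℝ :=
  1 + κ ^ r - C * R * noise n p δ ^ ((r - q) / 2)

end CorrDetect

end

noncomputable section

namespace CorrDetect

/-! Put `L = √(noise n p δ)`. Both error bounds rest on one event: every entry of the empirical
covariance matrix is within `4 * L` of its mean. By polarization an entry is a difference of
empirical second moments of the Gaussians `(X_i ± X_j) / 2`, so chi-square tails bound its failure
probability by `4 * exp (-n L²)`. The union bound over `p²` entries then gives exactly `δ`.

The rest is deterministic. Under the null, the threshold exceeds the noise and erases every
off-diagonal entry, so the statistic is at most `1 + O(L)`. Under the alternative, take a row of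
`offdiag S` whose `r`-th powers sum to `1`. By `rpow_le_threshold_add`, a nonzero entry `σ` loses at
most `O(L ^ (r - q) |σ| ^ q)`; sparsity sums these losses to `O(R L ^ (r - q))`, and the diagonal
loses `O(L)`. Since `r - q ≤ 1` and `L < 1`, all errors are `O(R L ^ (r - q))`, and `κ > κ̄` makes
`κ ^ r` more than twice the allowance for them. -/

/-! ### Chi-square concentration -/

/-- After squaring and using `1 + u ≤ exp u`, it remains that `(1 - 2t)(1 + 2t + 8t²) = 1 + 4t²(1 -
4t) ≥ 1`. Negative `t` is allowed, which serves the lower tail. -/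
lemma inv_sqrt_one_sub_two_mul_le {t : ℝ} (ht : t ≤ 1 / 4) :
    (√(1 - 2 * t))⁻¹ ≤ Real.exp (t + 4 * t ^ 2) := by
  have h1 : 0 < 1 - 2 * t := by linarith
  have h2 : 1 ≤ (1 - 2 * t) * Real.exp (t + 4 * t ^ 2) ^ 2 := by
    have h3 : Real.exp (t + 4 * t ^ 2) ^ 2 = Real.exp (2 * t + 8 * t ^ 2) := by
      rw [← Real.exp_nat_mul]; congr 1; push_cast; ring
    have h4 := Real.add_one_le_exp (2 * t + 8 * t ^ 2)
    rw [h3]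
    nlinarith [mul_le_mul_of_nonneg_left h4 h1.le, mul_nonneg (sq_nonneg t) h1.le,
      mul_nonneg (sq_nonneg t) (sub_nonneg.2 ht)]
  rw [inv_le_iff_one_le_mul₀ (Real.sqrt_pos.2 h1), mul_comm]
  refine (Real.one_le_sqrt.2 h2).trans_eq ?_
  rw [Real.sqrt_mul h1.le, Real.sqrt_sq (Real.exp_pos _).le]

lemma gaussianPDFReal_mul_exp_mul_sq (t x : ℝ) :
    gaussianPDFReal 0 1 x * Real.exp (t * x ^ 2) =
      (√(2 * Real.pi))⁻¹ * Real.exp (-(1 / 2 - t) * x ^ 2) := by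
  rw [gaussianPDFReal_def]
  simp only [NNReal.coe_one, mul_one, sub_zero]
  rw [mul_assoc, ← Real.exp_add]
  congr 2; ring

lemma integrable_exp_mul_sq_gaussianReal {t : ℝ} (ht : t < 1 / 2) :
    Integrable (fun x => Real.exp (t * x ^ 2)) (gaussianReal 0 1) := by
  rw [gaussianReal_of_var_ne_zero 0 one_ne_zero, integrable_withDensity_iff_integrable_smul'
    (measurable_gaussianPDF _ _) (ae_of_all _ fun _ => gaussianPDF_lt_top)]
  simp only [toReal_gaussianPDF, smul_eq_mul, gaussianPDFReal_mul_exp_mul_sq]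
  exact (integrable_exp_neg_mul_sq (by linarith)).const_mul _

lemma integral_exp_mul_sq_gaussianReal {t : ℝ} (ht : t < 1 / 2) :
    ∫ x, Real.exp (t * x ^ 2) ∂(gaussianReal 0 1) = (√(1 - 2 * t))⁻¹ := by
  rw [integral_gaussianReal_eq_integral_smul one_ne_zero]
  simp only [smul_eq_mul, gaussianPDFReal_mul_exp_mul_sq]
  rw [integral_const_mul, integral_gaussian, ← Real.sqrt_inv, ← Real.sqrt_inv, ← Real.sqrt_mul
    (by positivity)]
  congr 1
  have h1 : 1 / 2 - t ≠ 0 := by linarith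
  have h2 : 1 - 2 * t ≠ 0 := by linarith
  field_simp

lemma mgf_sum_sq_le (n : ℕ) {t : ℝ} (ht : t ≤ 1 / 4) :
    mgf (fun x : Fin n → ℝ => ∑ k, x k ^ 2) (Measure.pi fun _ => gaussianReal 0 1) t ≤
      Real.exp (n * (t + 4 * t ^ 2)) := by
  have h : mgf (fun x : Fin n → ℝ => ∑ k, x k ^ 2) (Measure.pi fun _ => gaussianReal 0 1) t =
      ((√(1 - 2 * t))⁻¹) ^ n := by
    rw [mgf, ← integral_exp_mul_sq_gaussianReal (by linarith : t < 1 / 2)]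
    simp only [Finset.mul_sum, Real.exp_sum]
    rw [integral_fintype_prod_eq_pow (fun x => Real.exp (t * x ^ 2)), Fintype.card_fin]
  rw [h, Real.exp_nat_mul]
  exact pow_le_pow_left₀ (by positivity) (inv_sqrt_one_sub_two_mul_le ht) n

lemma integrable_exp_mul_sum_sq (n : ℕ) {t : ℝ} (ht : t < 1 / 2) :
    Integrable (fun x : Fin n → ℝ => Real.exp (t * ∑ k, x k ^ 2))
      (Measure.pi fun _ => gaussianReal 0 1) := by
  simp only [Finset.mul_sum, Real.exp_sum]
  exact Integrable.fintype_prod fun _ => integrable_exp_mul_sq_gaussianReal ht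

/-- A two-sided tail bound for the chi-square distribution with `n` degrees of freedom. -/
lemma measureReal_chiSq_deviation_le {n : ℕ} (hn : 0 < n) {L : ℝ} (hL₀ : 0 ≤ L) (hL : L ≤ 1 / 2) :
    (Measure.pi fun _ : Fin n => gaussianReal 0 1).real
      {x | 4 * L < |1 / (n : ℝ) * ∑ k, x k ^ 2 - 1|} ≤ 2 * Real.exp (-(n * L ^ 2)) := by
  set μ := Measure.pi fun _ : Fin n => gaussianReal 0 1
  have hn' : (0 : ℝ) < n := by exact_mod_cast hn
  have hup : μ.real {x | n * (1 + 4 * L) ≤ ∑ k, x k ^ 2} ≤ Real.exp (-(n * L ^ 2)) := by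
    -- `t = L / 2` minimizes the Chernoff exponent `n (4t² - 4Lt)`, with value `-n L²`; `L ≤ 1 / 2`
    -- keeps `t ≤ 1 / 4`.
    refine (measure_ge_le_exp_mul_mgf (t := L / 2) _ (by linarith)
      (integrable_exp_mul_sum_sq n (by linarith))).trans ?_
    refine (mul_le_mul_of_nonneg_left (mgf_sum_sq_le n (by linarith))
      (Real.exp_pos _).le).trans_eq ?_
    rw [← Real.exp_add]; congr 1; ring
  have hlow : μ.real {x | ∑ k, x k ^ 2 ≤ n * (1 - 4 * L)} ≤ Real.exp (-(n * L ^ 2)) := by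
    refine (measure_le_le_exp_mul_mgf (t := -(L / 2)) _ (by linarith)
      (integrable_exp_mul_sum_sq n (by linarith))).trans ?_
    refine (mul_le_mul_of_nonneg_left (mgf_sum_sq_le n (by linarith))
      (Real.exp_pos _).le).trans_eq ?_
    rw [← Real.exp_add]; congr 1; ring
  refine (measureReal_mono (fun x hx => ?_) (measure_ne_top _ _)).trans
    ((measureReal_union_le _ _).trans ((add_le_add hup hlow).trans_eq (two_mul _).symm))
  have hx' : 4 * L < |1 / (n : ℝ) * ∑ k, x k ^ 2 - 1| := hx
  have hs : (∑ k, x k ^ 2) = n * (1 / (n : ℝ) * ∑ k, x k ^ 2) := by field_simp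
  rcases lt_abs.1 hx' with h | h
  · left
    change n * (1 + 4 * L) ≤ ∑ k, x k ^ 2
    rw [hs]; exact mul_le_mul_of_nonneg_left (by linarith) hn'.le
  · right
    change ∑ k, x k ^ 2 ≤ n * (1 - 4 * L)
    rw [hs]; exact mul_le_mul_of_nonneg_left (by linarith) hn'.le

/-- Deviation of the empirical second moment of `n` i.i.d. centred Gaussian variables. -/
lemma measureReal_sq_deviation_le {E : Type*} [MeasurableSpace E] {μ : Measure E}
    [IsProbabilityMeasure μ] {f : E → ℝ} (hf : Measurable f) {v : NNReal}
    (hμ : μ.map f = gaussianReal 0 v) {n : ℕ} (hn : 0 < n) {L : ℝ} (hL₀ : 0 ≤ L)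
    (hL : L ≤ 1 / 2) :
    (Measure.pi fun _ : Fin n => μ).real
      {X | 4 * L * v < |1 / (n : ℝ) * ∑ k, f (X k) ^ 2 - v|} ≤ 2 * Real.exp (-(n * L ^ 2)) := by
  set A : Set (Fin n → ℝ) := {x | 4 * L * v < |1 / (n : ℝ) * ∑ k, x k ^ 2 - v|}
  have hA : MeasurableSet A := measurableSet_lt measurable_const (by fun_prop)
  have h1 : (Measure.pi fun _ : Fin n => μ).map (fun X k => f (X k)) =
      Measure.pi fun _ : Fin n => gaussianReal 0 v := by
    rw [← hμ]
    have : IsProbabilityMeasure (μ.map f) := Measure.isProbabilityMeasure_map hf.aemeasurable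
    exact Measure.pi_map_pi fun _ => hf.aemeasurable
  have h2 : (Measure.pi fun _ : Fin n => gaussianReal 0 1).map (fun x k => √v * x k) =
      Measure.pi fun _ : Fin n => gaussianReal 0 v := by
    have h3 : (gaussianReal 0 1).map (fun x => √(v : ℝ) * x) = gaussianReal 0 v := by
      rw [gaussianReal_map_const_mul]
      congr 1
      · simp
      · ext; simp
    have : IsProbabilityMeasure ((gaussianReal 0 1).map (fun x => √(v : ℝ) * x)) := by
      rw [h3]; infer_instance
    rw [← h3]
    exact Measure.pi_map_pi fun _ => by fun_prop
  have h3 : (Measure.pi fun _ : Fin n => μ).real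
      {X | 4 * L * v < |1 / (n : ℝ) * ∑ k, f (X k) ^ 2 - v|} =
      (Measure.pi fun _ : Fin n => gaussianReal 0 1).real ((fun x k => √v * x k) ⁻¹' A) := by
    rw [← map_measureReal_apply (by fun_prop) hA, h2, ← h1,
      map_measureReal_apply (by fun_prop) hA]
    rfl
  rw [h3]
  refine (measureReal_mono (fun x hx => ?_) (measure_ne_top _ _)).trans
    (measureReal_chiSq_deviation_le hn hL₀ hL)
  have hx' : 4 * L * v < |1 / (n : ℝ) * ∑ k, (√(v : ℝ) * x k) ^ 2 - v| := hx
  have hs : 1 / (n : ℝ) * ∑ k, (√(v : ℝ) * x k) ^ 2 - v =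
      (1 / (n : ℝ) * ∑ k, x k ^ 2 - 1) * v := by
    simp only [mul_pow, Real.sq_sqrt v.coe_nonneg, ← Finset.mul_sum]; ring
  rw [hs, abs_mul, abs_of_nonneg v.coe_nonneg] at hx'
  exact lt_of_mul_lt_mul_right hx' v.coe_nonneg

/-! ### Deviation of the empirical covariance matrix -/

lemma multivariateGaussian_map_add {p : ℕ} {G : Matrix (Fin p) (Fin p) ℝ} (hG : G.PosSemidef)
    (i j : Fin p) (c : ℝ) :
    (multivariateGaussian 0 G).map (fun x => (x i + c * x j) / 2) =
      gaussianReal 0 ((G i i + 2 * c * G i j + c ^ 2 * G j j) / 4).toNNReal := by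
  set l : StrongDual ℝ (EuclideanSpace ℝ (Fin p)) :=
    (1 / 2 : ℝ) • (EuclideanSpace.proj i + c • EuclideanSpace.proj j) with hl
  have hle : (l : EuclideanSpace ℝ (Fin p) → ℝ) = fun x => (x i + c * x j) / 2 := by
    ext x; simp [hl]; ring
  have hmem (k : Fin p) : MemLp (fun x : EuclideanSpace ℝ (Fin p) => x k) 2
      (multivariateGaussian 0 G) :=
    IsGaussian.memLp_dual _ (EuclideanSpace.proj (𝕜 := ℝ) k) 2 (by simp)
  rw [← hle, IsGaussian.map_eq_gaussianReal,
    ContinuousLinearMap.integral_comp_id_comm IsGaussian.integrable_id,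
    integral_id_multivariateGaussian, map_zero]
  congr 2
  have h1 : (l : EuclideanSpace ℝ (Fin p) → ℝ) = fun x => (1 / 2) * (x i + c * x j) := by
    rw [hle]; ext x; ring
  rw [h1, variance_const_mul, variance_fun_add (hmem i) ((hmem j).const_mul c),
    variance_const_mul, covariance_const_mul_right, covariance_eval_multivariateGaussian hG,
    variance_eval_multivariateGaussian hG, variance_eval_multivariateGaussian hG]
  ring

/-- Deviation of an entry of the empirical covariance matrix, by polarization. -/
lemma measureReal_empCov_deviation_le {n p : ℕ} (hn : 0 < n) {G : Matrix (Fin p) (Fin p) ℝ}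
    (hG : G.PosSemidef) (hd : ∀ i, G i i = 1) {L : ℝ} (hL₀ : 0 ≤ L) (hL : L ≤ 1 / 2)
    (i j : Fin p) :
    (gaussianSample n G).real {X | 4 * L < |empCov X i j - G i j|} ≤
      4 * Real.exp (-(n * L ^ 2)) := by
  have key (c : ℝ) (hc : c ^ 2 = 1) (v : NNReal) (hv : ((1 + c * G i j) / 2).toNNReal = v) :
      (gaussianSample n G).real {X | 4 * L * v <
        |1 / (n : ℝ) * ∑ k, ((X k i + c * X k j) / 2) ^ 2 - v|} ≤ 2 * Real.exp (-(n * L ^ 2)) := by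
    have hmap : (multivariateGaussian 0 G).map (fun x => (x i + c * x j) / 2) =
        gaussianReal 0 v := by
      rw [multivariateGaussian_map_add hG, ← hv, hd, hd, hc]
      ring_nf
    exact measureReal_sq_deviation_le (by fun_prop) hmap hn hL₀ hL
  -- Testing positivity of `G` on `e_i + c e_j` shows that `toNNReal` truncates nothing.
  have hnn (c : ℝ) (hc : c ^ 2 = 1) : 0 ≤ (1 + c * G i j) / 2 := by
    have h := hG.dotProduct_mulVec_nonneg (Pi.single i 1 + c • Pi.single j 1)
    simp [Matrix.mulVec_add, Matrix.mulVec_smul, add_dotProduct, hd] at h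
    have hs : G j i = G i j := by simpa using hG.isHermitian.apply i j
    rw [hs] at h
    nlinarith
  -- Each deviation is proportional to its variance, and `v₁ + v₂ = 1`, so the two add up to `4 *
  -- L`.
  set v₁ := ((1 + 1 * G i j) / 2).toNNReal with hv₁
  set v₂ := ((1 + (-1) * G i j) / 2).toNNReal with hv₂
  have e₁ : (v₁ : ℝ) = (1 + 1 * G i j) / 2 := Real.coe_toNNReal _ (hnn 1 (by norm_num))
  have e₂ : (v₂ : ℝ) = (1 + (-1) * G i j) / 2 := Real.coe_toNNReal _ (hnn (-1) (by norm_num))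
  have : IsProbabilityMeasure (gaussianSample n G) := by unfold gaussianSample; infer_instance
  refine (measureReal_mono (fun X hX => ?_) (measure_ne_top _ _)).trans
    ((measureReal_union_le _ _).trans ((add_le_add (key 1 (by norm_num) v₁ rfl)
      (key (-1) (by norm_num) v₂ rfl)).trans_eq (by ring)))
  by_contra hcon
  simp only [Set.mem_union, Set.mem_ofPred_eq, not_or, not_lt] at hcon hX
  obtain ⟨h1, h2⟩ := hcon
  have hpol : empCov X i j = 1 / (n : ℝ) * ∑ k, ((X k i + 1 * X k j) / 2) ^ 2 -
      1 / (n : ℝ) * ∑ k, ((X k i + (-1) * X k j) / 2) ^ 2 := by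
    rw [← mul_sub, ← Finset.sum_sub_distrib]
    simp only [empCov, Matrix.of_apply]
    congr 1
    exact Finset.sum_congr rfl fun k _ => by ring
  rw [hpol] at hX
  rw [abs_le] at h1 h2
  rw [e₁] at h1; rw [e₂] at h2
  rcases lt_abs.1 hX with h | h <;> linarith [h1.1, h1.2, h2.1, h2.2]

/-- Uniform deviation of the empirical covariance matrix. -/
lemma measureReal_exists_empCov_deviation_le {n p : ℕ} (hn : 0 < n)
    {G : Matrix (Fin p) (Fin p) ℝ} (hG : G.PosSemidef) (hd : ∀ i, G i i = 1) {L : ℝ}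
    (hL₀ : 0 ≤ L) (hL : L ≤ 1 / 2) :
    (gaussianSample n G).real {X | ∃ i j, 4 * L < |empCov X i j - G i j|} ≤
      (p : ℝ) ^ 2 * (4 * Real.exp (-(n * L ^ 2))) := by
  have h : {X : Sample n p | ∃ i j, 4 * L < |empCov X i j - G i j|} =
      ⋃ ij : Fin p × Fin p, {X | 4 * L < |empCov X ij.1 ij.2 - G ij.1 ij.2|} := by
    ext X; simp
  rw [h]
  refine (measureReal_iUnion_fintype_le _).trans ((Finset.sum_le_sum fun ij _ =>
    measureReal_empCov_deviation_le hn hG hd hL₀ hL ij.1 ij.2).trans_eq ?_)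
  simp [sq, mul_assoc]

/-! ### Powers under perturbation and thresholding -/

lemma one_sub_le_rpow {r b x : ℝ} (hr : 0 < r) (hb₀ : 0 ≤ b) (hb : b ≤ 1 / 2) (hx : 1 - b ≤ x) :
    1 - 2 * r * b ≤ x ^ r := by
  have hx0 : 0 < x := by linarith
  have h1 : 1 - x⁻¹ ≤ Real.log x := Real.one_sub_inv_le_log_of_pos hx0
  have h2 : x⁻¹ ≤ 1 + 2 * b := by
    rw [inv_le_iff_one_le_mul₀ hx0]
    nlinarith
  have h3 : -(2 * b) * r ≤ Real.log x * r := mul_le_mul_of_nonneg_right (by linarith) hr.le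
  rw [Real.rpow_def_of_pos hx0]
  linarith [Real.add_one_le_exp (Real.log x * r)]

lemma rpow_le_one_add {r b x : ℝ} (hr : 0 < r) (hb₀ : 0 ≤ b) (hb : b ≤ 1) (hx₀ : 0 ≤ x)
    (hx : x ≤ 1 + b) : x ^ r ≤ 1 + r * Real.exp r * b := by
  have h1 : x ^ r ≤ Real.exp (b * r) := by
    rw [Real.exp_mul]
    exact Real.rpow_le_rpow hx₀ (hx.trans (by linarith [Real.add_one_le_exp b])) hr.le
  have h2 : Real.exp (b * r) * (1 - b * r) ≤ 1 := by
    calc Real.exp (b * r) * (1 - b * r) ≤ Real.exp (b * r) * Real.exp (-(b * r)) :=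
          mul_le_mul_of_nonneg_left (by linarith [Real.add_one_le_exp (-(b * r))])
            (Real.exp_pos _).le
      _ = 1 := by rw [← Real.exp_add]; simp
  have h3 : Real.exp (b * r) ≤ Real.exp r := Real.exp_le_exp.2 (by nlinarith)
  nlinarith [mul_le_mul_of_nonneg_left h3 (mul_nonneg hb₀ hr.le)]

/-- Hard thresholding at level `2 C₀ L` of a `4 L`-perturbation `y` of `t` loses at most
`O(L ^ (r - q) t ^ q)` in the `r`-th power. -/
lemma rpow_le_threshold_add {r q C₀ L t y : ℝ} (hr : 0 < r) (hq₀ : 0 ≤ q) (hrq : r - 1 ≤ q)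
    (hqr : q < r) (hC₀ : 4 ≤ C₀) (hL : 0 < L) (ht : 0 < t) (hy : 0 ≤ y) (hyt : |y - t| ≤ 4 * L) :
    t ^ r ≤ (if 2 * C₀ * L < y then y else 0) ^ r +
      ((3 * C₀) ^ r + 8 * r) * L ^ (r - q) * t ^ q := by
  obtain ⟨hyt₁, hyt₂⟩ := abs_le.1 hyt
  have hCL : 4 * L ≤ C₀ * L := mul_le_mul_of_nonneg_right hC₀ hL.le
  have hM : 0 < L ^ (r - q) := Real.rpow_pos_of_pos hL _
  have htq : 0 < t ^ q := Real.rpow_pos_of_pos ht _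
  have hA : 0 < (3 * C₀) ^ r := Real.rpow_pos_of_pos (by linarith) _
  have hsplit : t ^ r = t ^ (r - q) * t ^ q := by rw [← Real.rpow_add ht]; congr 1; ring
  have hpos : 0 ≤ 8 * r * L ^ (r - q) * t ^ q := by positivity
  split_ifs with h
  · rcases le_total t y with hty | hty
    · have := Real.rpow_le_rpow ht.le hty hr.le
      have : 0 ≤ ((3 * C₀) ^ r + 8 * r) * L ^ (r - q) * t ^ q := by positivity
      linarith
    · have hLt : 8 * L ≤ t := by linarith
      have h1 : 1 - 2 * r * (4 * L / t) ≤ (y / t) ^ r := by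
        refine one_sub_le_rpow hr (by positivity) ?_ ?_
        · rw [div_le_iff₀ ht]; linarith
        · rw [le_div_iff₀ ht, sub_mul, div_mul_cancel₀ _ ht.ne']; linarith
      rw [Real.div_rpow hy ht.le, le_div_iff₀ (Real.rpow_pos_of_pos ht _)] at h1
      have h2 : L / t * t ^ r ≤ L ^ (r - q) * t ^ q := by
        have e : L / t = (L / t) ^ (1 : ℝ) := (Real.rpow_one _).symm
        -- A surviving entry has relative error `4 * L / t`, a loss linear in `L / t ≤ 1`; `r - q ≤
        -- 1` trades it for the power `r - q`.
        have h3 : L / t ≤ (L / t) ^ (r - q) := by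
          conv_lhs => rw [e]
          exact Real.rpow_le_rpow_of_exponent_ge (by positivity)
            ((div_le_one ht).2 (by linarith)) (by linarith)
        refine (mul_le_mul_of_nonneg_right h3 (Real.rpow_pos_of_pos ht _).le).trans_eq ?_
        rw [Real.div_rpow hL.le ht.le, hsplit]
        field_simp
      have h4 : (1 - 2 * r * (4 * L / t)) * t ^ r = t ^ r - 8 * r * (L / t * t ^ r) := by ring
      have h5 := mul_le_mul_of_nonneg_left h2 (by linarith : 0 ≤ 8 * r)
      have : 0 ≤ (3 * C₀) ^ r * L ^ (r - q) * t ^ q := by positivity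
      rw [h4] at h1
      linarith
  · rw [Real.zero_rpow hr.ne', zero_add]
    -- A killed entry satisfies `t ≤ y + 4 * L ≤ (2 * C₀ + 4) * L`, and `4 ≤ C₀`.
    have ht3 : t ≤ 3 * C₀ * L := by linarith
    have h1 : t ^ (r - q) ≤ (3 * C₀) ^ r * L ^ (r - q) := by
      refine (Real.rpow_le_rpow ht.le ht3 (by linarith)).trans ?_
      rw [Real.mul_rpow (by linarith) hL.le]
      exact mul_le_mul_of_nonneg_right
        (Real.rpow_le_rpow_of_exponent_le (by linarith) (by linarith)) hM.le
    rw [hsplit]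
    linarith [mul_le_mul_of_nonneg_right h1 htq.le]

/-! ### The statistic on the good event -/

lemma abs_threshCov_off {n p : ℕ} (τ : ℝ) (X : Sample n p) {i j : Fin p} (hij : i ≠ j) :
    |threshCov τ X i j| = if τ < |empCov X i j| then |empCov X i j| else 0 := by
  simp only [threshCov, Matrix.of_apply, if_neg hij]
  split_ifs <;> simp

lemma threshCov_diag {n p : ℕ} (τ : ℝ) (X : Sample n p) (i : Fin p) :
    threshCov τ X i i = empCov X i i := by
  simp [threshCov]

/-- On the event of uniform deviation at most `4 L` from the identity, the statistic is close
to `1`. -/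
lemma ellFunctional_threshCov_le {n p : ℕ} (hp : 0 < p) {r τ L : ℝ} (hr : 0 < r) (hL₀ : 0 ≤ L)
    (hL : L ≤ 1 / 8) (hτ : 4 * L ≤ τ) {X : Sample n p}
    (hX : ∀ i j, |empCov X i j - (1 : Matrix (Fin p) (Fin p) ℝ) i j| ≤ 4 * L) :
    ellFunctional r (threshCov τ X) ≤ 1 + 4 * (r * Real.exp r) * L := by
  have : Nonempty (Fin p) := ⟨⟨0, hp⟩⟩
  refine ciSup_le fun i => ?_
  rw [Finset.sum_eq_single i]
  · rw [threshCov_diag]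
    have h := hX i i
    rw [Matrix.one_apply_eq] at h
    have h2 : |empCov X i i| ≤ 1 + 4 * L := by
      rw [abs_le] at h ⊢; constructor <;> linarith [h.1, h.2]
    exact (rpow_le_one_add hr (by linarith) (by linarith) (abs_nonneg _) h2).trans_eq (by ring)
  · intro j _ hji
    have h := hX i j
    rw [Matrix.one_apply_ne hji.symm, sub_zero] at h
    rw [abs_threshCov_off _ _ hji.symm, if_neg (by linarith), Real.zero_rpow hr.ne']
  · simp

/-- Reduces the union over `q' ≤ q` to `q` itself: in a row attaining the maximum all entries are at
most `1` in modulus, so raising the exponent lowers their powers. -/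
lemma exists_row_of_mem_altParams {p : ℕ} (hp : 0 < p) {r q R : ℝ} (hr : 0 < r)
    {S : Matrix (Fin p) (Fin p) ℝ} (hS : S ∈ altParams p r q R) :
    S.PosSemidef ∧ (∀ i, S i i = 1) ∧
      ∃ i, ∑ j, |offdiag S i j| ^ r = 1 ∧ (∀ j, |offdiag S i j| ≤ 1) ∧
        ∑ j, absPow q (offdiag S i j) ≤ R := by
  obtain ⟨hU, hell⟩ := hS
  simp only [Set.mem_iUnion] at hU
  obtain ⟨q', ⟨-, hq'⟩, hpsd, hR, hd⟩ := hU
  have : Nonempty (Fin p) := ⟨⟨0, hp⟩⟩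
  obtain ⟨i, hi⟩ := exists_eq_ciSup_of_finite (f := fun i => ∑ j, |offdiag S i j| ^ r)
  have hi1 : ∑ j, |offdiag S i j| ^ r = 1 := hi.trans hell
  have hle (j) : |offdiag S i j| ≤ 1 := by
    have h := Finset.single_le_sum (f := fun j => |offdiag S i j| ^ r)
      (fun j _ => Real.rpow_nonneg (abs_nonneg _) r) (Finset.mem_univ j)
    rw [hi1] at h
    by_contra hlt
    exact absurd h (not_le.2 (Real.one_lt_rpow (not_le.1 hlt) hr))
  refine ⟨hpsd, hd, i, hi1, hle, (Finset.sum_le_sum fun j _ => ?_).trans (hR i)⟩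
  have hnn : 0 ≤ absPow q' (S i j) := by unfold absPow; split_ifs <;> positivity
  by_cases h0 : offdiag S i j = 0
  · simpa [h0, absPow] using hnn
  · have hij : i ≠ j := fun h => h0 (by simp [offdiag, h])
    have e : offdiag S i j = S i j := by simp [offdiag, hij]
    rw [← e, absPow, absPow, if_neg h0, if_neg h0]
    exact Real.rpow_le_rpow_of_exponent_ge (abs_pos.2 h0) (hle j) hq'

/-- On the event of uniform deviation at most `4 L`, the statistic is large under the
alternative. -/
lemma le_ellFunctional_threshCov {n p : ℕ} (hp : 0 < p) {r q R C₀ L κ : ℝ} (hr : 0 < r)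
    (hq₀ : 0 ≤ q) (hrq : r - 1 ≤ q) (hqr : q < r) (hC₀ : 4 ≤ C₀) (hL₀ : 0 < L) (hL : L ≤ 1 / 8)
    (hκ₀ : 0 < κ) (hκ : κ ≤ 1) {S : Matrix (Fin p) (Fin p) ℝ} (hS : S ∈ altParams p r q R)
    {X : Sample n p} (hX : ∀ i j, |empCov X i j - (1 + κ • offdiag S) i j| ≤ 4 * L) :
    1 - 8 * r * L + κ ^ r - ((3 * C₀) ^ r + 8 * r) * L ^ (r - q) * R ≤
      ellFunctional r (threshCov (2 * C₀ * L) X) := by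
  obtain ⟨-, -, i, hsum, hle, hR⟩ := exists_row_of_mem_altParams hp hr hS
  set K := ((3 * C₀) ^ r + 8 * r) * L ^ (r - q) with hK
  have hK0 : 0 ≤ K := by positivity
  refine le_trans ?_ (le_ciSup (f := fun i => ∑ j, |threshCov (2 * C₀ * L) X i j| ^ r)
    (Set.finite_range _).bddAbove i)
  -- One inequality covers diagonal and off-diagonal entries, so that summing over the row gives the
  -- claim.
  have hentry (j : Fin p) : κ ^ r * |offdiag S i j| ^ r + (if i = j then 1 - 8 * r * L else 0) ≤
      |threshCov (2 * C₀ * L) X i j| ^ r + K * absPow q (offdiag S i j) := by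
    have hdev := hX i j
    by_cases hij : i = j
    · subst hij
      have h0 : offdiag S i i = 0 := by simp [offdiag]
      simp only [Matrix.add_apply, Matrix.one_apply_eq, Matrix.smul_apply, h0, smul_zero,
        add_zero] at hdev
      have h1 : 1 - 4 * L ≤ |empCov X i i| := by
        linarith [(abs_le.1 hdev).1, le_abs_self (empCov X i i)]
      have h2 := one_sub_le_rpow hr (by linarith) (by linarith) h1
      simp only [h0, abs_zero, Real.zero_rpow hr.ne', mul_zero, zero_add, if_true, absPow,
        add_zero, threshCov_diag]
      linarith
    · simp only [if_neg hij, add_zero]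
      simp only [Matrix.add_apply, Matrix.one_apply_ne hij, Matrix.smul_apply, zero_add,
        smul_eq_mul] at hdev
      by_cases h0 : offdiag S i j = 0
      · simp only [h0, abs_zero, Real.zero_rpow hr.ne', mul_zero, absPow, if_true, add_zero]
        positivity
      · have hs : 0 < |offdiag S i j| := abs_pos.2 h0
        have h1 : |(|empCov X i j|) - κ * (|offdiag S i j|)| ≤ 4 * L := by
          refine le_trans ?_ hdev
          rw [show κ * |offdiag S i j| = |κ * offdiag S i j| by rw [abs_mul, abs_of_pos hκ₀]]
          exact abs_abs_sub_abs_le _ _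
        have h2 := rpow_le_threshold_add hr hq₀ hrq hqr hC₀ hL₀ (mul_pos hκ₀ hs)
          (abs_nonneg (empCov X i j)) h1
        rw [← abs_threshCov_off _ _ hij, ← hK, Real.mul_rpow hκ₀.le hs.le] at h2
        refine h2.trans (add_le_add_right (mul_le_mul_of_nonneg_left ?_ hK0) _)
        rw [absPow, if_neg h0]
        exact Real.rpow_le_rpow (by positivity) (mul_le_of_le_one_left hs.le hκ) hq₀
  have htot := Finset.sum_le_sum fun j (_ : j ∈ Finset.univ) => hentry j
  rw [Finset.sum_add_distrib, Finset.sum_add_distrib, ← Finset.mul_sum, ← Finset.mul_sum, hsum,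
    Finset.sum_ite_eq, if_pos (Finset.mem_univ i)] at htot
  linarith [mul_le_mul_of_nonneg_left hR hK0]

/-! ### Calibration of the noise level -/

lemma posSemidef_one_add_smul_offdiag {p : ℕ} {S : Matrix (Fin p) (Fin p) ℝ}
    (hS : S.PosSemidef) (hd : ∀ i, S i i = 1) {κ : ℝ} (hκ₀ : 0 ≤ κ) (hκ : κ ≤ 1) :
    (1 + κ • offdiag S).PosSemidef := by
  have h : 1 + κ • offdiag S = (1 - κ) • (1 : Matrix (Fin p) (Fin p) ℝ) + κ • S := by
    ext i j
    by_cases hij : i = j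
    · subst hij; simp [offdiag, hd]
    · simp [offdiag, hij]
  rw [h]
  exact (Matrix.PosSemidef.one.smul (sub_nonneg.2 hκ)).add (hS.smul hκ₀)

lemma noise_pos {n p : ℕ} (hn : 0 < n) (hp : 0 < p) {δ : ℝ} (hδ₀ : 0 < δ) (hδ : δ < 1) :
    0 < noise n p δ := by
  have h1 : 0 ≤ Real.log p := Real.log_nonneg (by exact_mod_cast hp)
  have h2 : 0 < Real.log (4 / δ) := Real.log_pos (by rw [lt_div_iff₀ hδ₀]; linarith)
  exact div_pos (by linarith) (by exact_mod_cast hn)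

lemma card_mul_exp_neg_noise {n p : ℕ} (hn : 0 < n) (hp : 0 < p) {δ : ℝ} (hδ₀ : 0 < δ) :
    (p : ℝ) ^ 2 * (4 * Real.exp (-(n * noise n p δ))) = δ := by
  have hn' : (n : ℝ) ≠ 0 := by positivity
  have hp' : (0 : ℝ) < p := by exact_mod_cast hp
  have h : -(n * noise n p δ) = Real.log (((p : ℝ) ^ 2 * (4 / δ))⁻¹) := by
    rw [Real.log_inv, Real.log_mul (by positivity) (by positivity), Real.log_pow, noise,
      mul_div_cancel₀ _ hn']
    push_cast; ring
  rw [h, Real.exp_log (by positivity)]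
  field_simp

/-- The assumption `κ̄ < 1` is what places `L` in the range where the tail bound and the linearized
powers apply. It forces a power of the noise with exponent at most `1 / 2` below `1 / 8`. -/
lemma sqrt_noise_le {n p : ℕ} {r q R C δ : ℝ} (hr : 0 < r) (hq₀ : 0 ≤ q)
    (hqr : q ≤ r) (hR : 1 ≤ R) (hC : 4 ≤ C) (hlam : 0 < noise n p δ)
    (hκ : kappaBar C n p r q R δ < 1) : √(noise n p δ) ≤ 1 / 8 := by
  have hR' : 1 ≤ R ^ (1 / r) := Real.one_le_rpow hR (by positivity)
  have hpow := Real.rpow_pos_of_pos hlam ((r - q) / (2 * r))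
  have h1 : noise n p δ ^ ((r - q) / (2 * r)) ≤ 1 / 8 := by
    unfold kappaBar at hκ
    have : 8 ≤ 2 * C * R ^ (1 / r) := by nlinarith
    nlinarith
  refine le_trans ?_ h1
  rw [Real.sqrt_eq_rpow]
  have he : (r - q) / (2 * r) ≤ 1 / 2 := by rw [div_le_iff₀ (by linarith)]; linarith
  rcases le_total (noise n p δ) 1 with hle | hge
  · exact Real.rpow_le_rpow_of_exponent_ge hlam hle he
  · linarith [Real.one_le_rpow hge (div_nonneg (sub_nonneg.2 hqr) (by linarith : 0 ≤ 2 * r))]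

lemma kappaBar_rpow {n p : ℕ} {r q R C δ : ℝ} (hr : 0 < r) (hR : 0 ≤ R) (hC : 0 ≤ C)
    (hlam : 0 < noise n p δ) :
    kappaBar C n p r q R δ ^ r = (2 * C) ^ r * (R * noise n p δ ^ ((r - q) / 2)) := by
  unfold kappaBar
  have hpow := Real.rpow_pos_of_pos hlam ((r - q) / (2 * r))
  rw [Real.mul_rpow (by positivity) hpow.le, Real.mul_rpow (by positivity) (by positivity),
    ← Real.rpow_mul hR, ← Real.rpow_mul hlam.le, one_div_mul_cancel hr.ne', Real.rpow_one, mul_assoc,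
    show (r - q) / (2 * r) * r = (r - q) / 2 by field_simp]

/-- A test that is right whenever the empirical covariance matrix is uniformly close to the true
one errs with probability at most `δ`. -/
lemma gaussianSample_le_of_deviation {n p : ℕ} (hn : 0 < n) (hp : 0 < p) {δ : ℝ} (hδ₀ : 0 < δ)
    (hδ : δ < 1) (hL : √(noise n p δ) ≤ 1 / 2) {G : Matrix (Fin p) (Fin p) ℝ}
    (hG : G.PosSemidef) (hd : ∀ i, G i i = 1) {A : Set (Sample n p)}
    (hA : ∀ X, (∀ i j, |empCov X i j - G i j| ≤ 4 * √(noise n p δ)) → X ∉ A) :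
    gaussianSample n G A ≤ ENNReal.ofReal δ := by
  have : IsProbabilityMeasure (gaussianSample n G) := by unfold gaussianSample; infer_instance
  have h := measureReal_exists_empCov_deviation_le hn hG hd (Real.sqrt_nonneg _) hL
  rw [Real.sq_sqrt (noise_pos hn hp hδ₀ hδ).le, card_mul_exp_neg_noise hn hp hδ₀] at h
  refine (measure_mono fun X hXA => ?_).trans
    ((ENNReal.le_ofReal_iff_toReal_le (measure_ne_top _ _) hδ₀.le).2 h)
  by_contra hX
  simp only [Set.mem_ofPred_eq, not_exists, not_lt] at hX
  exact hA X hX hXA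

end CorrDetect

end

/-! ### Choice of constants and conclusion -/

theorem theorem4p3 (r : ℝ) (hr : 0 < r) (C₀ : ℝ) (hC₀ : 4 ≤ C₀) :
    ∃ C₁ C : ℝ, 0 < C₁ ∧ C₁ ≤ C ∧
      ∀ (n p : ℕ) (q R δ : ℝ), 0 < n → 0 < p → 0 ≤ q → r - 1 ≤ q → q < r → 1 ≤ R →
        0 < δ → δ < 1 → CorrDetect.kappaBar C n p r q R δ < 1 →
        ∀ κ : ℝ, CorrDetect.kappaBar C n p r q R δ < κ → κ ≤ 1 →
          CorrDetect.sLow C₁ n p r q R δ < CorrDetect.sHigh C₁ n p r q R δ κ ∧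
          ∀ s ∈ Set.Icc (CorrDetect.sLow C₁ n p r q R δ) (CorrDetect.sHigh C₁ n p r q R δ κ),
            CorrDetect.Discriminates
              (CorrDetect.corrTest (n := n) (p := p) r (CorrDetect.tau C₀ n p δ) s)
              κ (CorrDetect.altParams p r q R) δ := by
  set A := (3 * C₀) ^ r with hA
  have hA0 : 0 < A := Real.rpow_pos_of_pos (by linarith) _
  set B := r * Real.exp r with hB
  have hB0 : 0 < B := by positivity
  -- `4 * B` pays for the null. `A + 16 * r` pays for the alternative: `A + 8 * r` for thresholding,
  -- `8 * r` for the diagonal.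
  set C₁ := A + 16 * r + 4 * B + 1 with hC₁
  have hC₁0 : 0 < C₁ := by positivity
  have hD0 : 0 < (2 * C₁) ^ (1 / r) := by positivity
  -- The summands give `C₁ ≤ C`, the bound `4 ≤ C` needed for `L ≤ 1 / 8`, and `2 * C₁ ≤ (2 * C) ^
  -- r`, which separates `s₀` from `s₁`.
  set C := C₁ + 4 + (2 * C₁) ^ (1 / r) with hC
  refine ⟨C₁, C, hC₁0, by linarith, ?_⟩
  intro n p q R δ hn hp hq₀ hrq hqr hR hδ₀ hδ hbar κ hbarκ hκ
  have hlam := CorrDetect.noise_pos hn hp hδ₀ hδ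
  have hL := CorrDetect.sqrt_noise_le hr hq₀ hqr.le hR (by linarith : 4 ≤ C) hlam hbar
  have hCr : 2 * C₁ ≤ (2 * C) ^ r := by
    calc 2 * C₁ = ((2 * C₁) ^ (1 / r)) ^ r := by
          rw [← Real.rpow_mul (by positivity), one_div_mul_cancel hr.ne', Real.rpow_one]
      _ ≤ (2 * C) ^ r := Real.rpow_le_rpow hD0.le (by linarith) hr.le
  have hbar0 : 0 < CorrDetect.kappaBar C n p r q R δ := by
    unfold CorrDetect.kappaBar
    have : 0 < C := by linarith
    positivity
  have hκ₀ : 0 < κ := hbar0.trans hbarκ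
  have hκr : CorrDetect.kappaBar C n p r q R δ ^ r < κ ^ r := Real.rpow_lt_rpow hbar0.le hbarκ hr
  rw [CorrDetect.kappaBar_rpow hr (by linarith) (by linarith) hlam] at hκr
  set L := √(CorrDetect.noise n p δ) with hLdef
  have hL₀ : 0 < L := Real.sqrt_pos.2 hlam
  have hM : CorrDetect.noise n p δ ^ ((r - q) / 2) = L ^ (r - q) := by
    rw [hLdef, Real.sqrt_eq_rpow, ← Real.rpow_mul hlam.le]; congr 1; ring
  unfold CorrDetect.sLow CorrDetect.sHigh
  simp only [hM, mul_assoc] at hκr ⊢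
  have hM0 : 0 < L ^ (r - q) := Real.rpow_pos_of_pos hL₀ _
  -- The diagonal error is absorbed here, by `r - 1 ≤ q` and `1 ≤ R`.
  have hLM : L ≤ R * L ^ (r - q) := by
    have h1 : L ^ (1 : ℝ) ≤ L ^ (r - q) :=
      Real.rpow_le_rpow_of_exponent_ge hL₀ (by linarith) (by linarith)
    rw [Real.rpow_one] at h1
    nlinarith
  set M := R * L ^ (r - q) with hMdef
  have hMpos : 0 < M := hL₀.trans_le hLM
  have hCM := mul_le_mul_of_nonneg_right hCr hMpos.le
  refine ⟨by linarith, ?_⟩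
  rintro s ⟨hs₀, hs₁⟩
  have hτ : CorrDetect.tau C₀ n p δ = 2 * C₀ * L := rfl
  rw [CorrDetect.Discriminates, hτ]
  refine max_le ?_ (iSup₂_le fun S hS => ?_)
  · refine CorrDetect.gaussianSample_le_of_deviation hn hp hδ₀ hδ (by linarith)
      Matrix.PosSemidef.one (fun i => Matrix.one_apply_eq i) fun X hX hrej => ?_
    have h1 := CorrDetect.ellFunctional_threshCov_le hp hr hL₀.le hL
      (by nlinarith : 4 * L ≤ 2 * C₀ * L) hX
    have h2 : s ≤ CorrDetect.ellFunctional r (CorrDetect.threshCov (2 * C₀ * L) X) := by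
      by_contra hlt
      simp [CorrDetect.corrTest, hlt] at hrej
    have h3 : C₁ * M = (A + 16 * r + 1) * M + 4 * B * M := by rw [hC₁]; ring
    have h4 : 4 * B * L ≤ 4 * B * M := mul_le_mul_of_nonneg_left hLM (by positivity)
    have h5 : 0 < (A + 16 * r + 1) * M := by positivity
    linarith
  · obtain ⟨hpsd, hd, -⟩ := CorrDetect.exists_row_of_mem_altParams hp hr hS
    refine CorrDetect.gaussianSample_le_of_deviation hn hp hδ₀ hδ (by linarith)
      (CorrDetect.posSemidef_one_add_smul_offdiag hpsd hd hκ₀.le hκ)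
      (fun i => by simp [CorrDetect.offdiag]) fun X hX hacc => ?_
    have h1 := CorrDetect.le_ellFunctional_threshCov hp hr hq₀ hrq hqr hC₀ hL₀ hL hκ₀ hκ hS hX
    have h2 : ¬ s ≤ CorrDetect.ellFunctional r (CorrDetect.threshCov (2 * C₀ * L) X) := by
      intro hle
      simp [CorrDetect.corrTest] at hacc
      linarith
    have h3 : C₁ * M = (A + 8 * r) * M + 8 * r * M + (4 * B + 1) * M := by rw [hC₁]; ring
    have h4 : 8 * r * L ≤ 8 * r * M := mul_le_mul_of_nonneg_left hLM (by positivity)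
    have h5 : 0 < (4 * B + 1) * M := by positivity
    have h6 : (A + 8 * r) * L ^ (r - q) * R = (A + 8 * r) * M := by rw [hMdef]; ring
    rw [← hA, h6] at h1
    exact h2 (by linarith)
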